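/- Let $\mathcal{A}$ be an arena: a finite directed graph $(V,E)$ without dead ends (parallel edges allowed, an edge $e$ going from $\mathrm{In}(e)$ to $\mathrm{Out}(e)$), with $V$ split into Eve's vertices $V_{\text{Eve}}$ and Adam's vertices $V_{\text{Adam}}$, and let $\mathrm{col}\colon E\to\mathbb{Z}$. Let $\tau$ be a memoryless stochastic model of Adam: for each $v\in V_{\text{Adam}}$, $\tau(v)$ is a probability distribution on the edges leaving $v$, possibly giving probability zero to some of them. Let $\mathcal{P}$ be the Markov decision process obtained from $\mathcal{A}$ by making each $v\in V_{\text{Adam}}$ a random vertex with distribution $\tau(v)$, and let $E_\delta$ be the set of edges that leave a vertex of Eve or have positive probability under $\tau$. The mean payoff of a play $\pi=e_0e_1\cdots$ is $\mathsf{MP}^-(\pi)=\liminf_{n\to\infty}\frac1n\sum_{i<n}\mathrm{col}(e_i)$. A strategy of Eve (pure or randomised; it chooses an outgoing edge, or a distribution on outgoing edges, after each finite path ending in a vertex of Eve) has finite memory if it is implemented by a finite memory structure, updated along the edges taken, with the choice depending only on the current vertex and memory state. Let $\beta\in\mathbb{Q}$. A finite-memory strategy $\sigma$ satisfies the beyond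 worst-case (BWC) problem from $v_0$ for the thresholds $(0,\beta)$ if every play $\pi$ of $\mathcal{A}$ from $v_0$ consistent with $\sigma$ (whatever Adam does) has $\mathsf{MP}^-(\pi)>0$, and $\mathbb{E}^{\sigma}_{\mathcal{P},v_0}[\mathsf{MP}^-]>\beta$. An end component of $\mathcal{P}$ is a nonempty set $U\subseteq V$ such that every edge of $E_\delta$ leaving a random vertex of $U$ ends in $U$, and any two (possibly equal) vertices of $U$ are linked by a path with at least one edge, all of whose edges are in $E_\delta$ and stay within $U$. It is winning if from every vertex of $U$, in the game restricted to the edges of $E_\delta$ with both ends in $U$, Eve has a strategy ensuring $\mathsf{MP}^->0$ against every strategy of Adam; otherwise it is losing. Let $\mathcal{E}$ be the set of end components, $\mathcal{W}\subseteq\mathcal{E}$ the set of winning ones, and let $\mathrm{Inf}(\pi)$ be the set of vertices visited infinitely often by the play $\pi$. Then, for every initial vertex $v_0\in V$ and every finite-memory strategy $\sigma$ of Eve that satisfies the BWC problem from $v_0$, $$\mathbb{P}^{\sigma}_{\mathcal{P},v_0}\big[\{\pi \mid \mathrm{Inf}(\pi)\in\mathcal{W}\}\big]=1 \qquad\text{and}\qquad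 \mathbb{P}^{\sigma}_{\mathcal{P},v_0}\big[\{\pi \mid \mathrm{Inf}(\pi)\in\mathcal{E}\setminus\mathcal{W}\}\big]=0.$$ -/

import Mathlib

open MeasureTheory ProbabilityTheory Filter

noncomputable section

namespace BWC

/-- An arena on a directed graph with vertices `V` and edges `E` (parallel edges are allowed).
Eve owns the vertices in `eve`, Adam owns all the others, and no vertex is a dead end. -/
structure Arena (V E : Type*) where
  src : E → V
  tgt : E → V
  eve : Set V
  exists_edge : ∀ v, ∃ e, src e = v

/-- The first `n` edges of an infinite sequence of edges. -/
def history {E : Type*} (ρ : ℕ → E) (n : ℕ) : List E := List.ofFn fun i : Fin n => ρ i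

/-- The lim-inf mean payoff of a play with edges `ρ` and edge colours `col`. -/
def meanPayoff {E : Type*} (col : E → ℤ) (ρ : ℕ → E) : ℝ :=
  liminf (fun n : ℕ => (∑ i ∈ Finset.range n, (col (ρ i) : ℝ)) / n) atTop

namespace Arena

section Strategies

variable {V E : Type*} (A : Arena V E)

/-- The last vertex of the finite path that starts in `v` and takes the edges `h` in order. -/
def endpoint (v : V) (h : List E) : V := (h.getLast?).elim v A.tgt

/-- The vertex visited at time `n` by the play with edges `ρ` that starts in `v`. -/
def vertexAt (v : V) (ρ : ℕ → E) (n : ℕ) : V := A.endpoint v (history ρ n)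

/-- `h` is a finite path from `v` all of whose edges belong to `F`. -/
def IsPathIn (F : Set E) (v : V) (h : List E) : Prop :=
  ∀ (i : ℕ) (hi : i < h.length), h[i] ∈ F ∧ A.src h[i] = A.endpoint v (h.take i)

/-- `ρ` is an infinite path from `v` (a play) all of whose edges belong to `F`. -/
def IsPlayIn (F : Set E) (v : V) (ρ : ℕ → E) : Prop :=
  ∀ n, ρ n ∈ F ∧ A.src (ρ n) = A.vertexAt v ρ n

/-- The set of vertices visited infinitely often by the play `ρ` from `v`. -/
def infVisited (v : V) (ρ : ℕ → E) : Set V := {u | ∃ᶠ n in atTop, A.vertexAt v ρ n = u}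

/-- A randomised strategy of Eve: it maps the finite path from `v` with edges `h` to a distribution
on edges, supported by the edges leaving the last vertex whenever that vertex is Eve's. Its values on
paths that end in a vertex of Adam are never used. Pure strategies are those with Dirac values. -/
structure Strategy where
  act : V → List E → PMF E
  legal : ∀ v h, A.endpoint v h ∈ A.eve → ∀ e ∈ (act v h).support, A.src e = A.endpoint v h

/-- A (possibly randomised) strategy of Eve implemented with a memory structure
`(M, init, update)`; it is a finite-memory strategy when `M` is finite. -/
structure MemoryStrategy (M : Type*) where
  init : M
  update : M → E → M
  act : V → M → PMF E
  legal : ∀ v ∈ A.eve, ∀ m, ∀ e ∈ (act v m).support, A.src e = v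

variable {A} in
/-- The strategy implemented by a memory structure. -/
def MemoryStrategy.toStrategy {M : Type*} (σ : A.MemoryStrategy M) : A.Strategy where
  act v h := σ.act (A.endpoint v h) (h.foldl σ.update σ.init)
  legal _ _ hv e he := σ.legal _ hv _ e he

/-- A memoryless stochastic model of Adam: at every vertex of Adam, a distribution on the edges
leaving it (some of these edges may get probability zero). Together with the arena this is the
Markov decision process in which the vertices of Adam are random vertices. -/
structure StochasticModel where
  prob : V → PMF E
  legal : ∀ v ∉ A.eve, ∀ e ∈ (prob v).support, A.src e = v

variable {A}

/-- The play `ρ` from `v` is consistent with Eve's strategy `σ`. -/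
def Strategy.Consistent (σ : A.Strategy) (v : V) (ρ : ℕ → E) : Prop :=
  ∀ n, A.vertexAt v ρ n ∈ A.eve → ρ n ∈ (σ.act v (history ρ n)).support

open Classical in
/-- The distribution of the next edge after the path `h` from `v`. -/
def Strategy.step (σ : A.Strategy) (τ : A.StochasticModel) (v : V) (h : List E) : PMF E :=
  if A.endpoint v h ∈ A.eve then σ.act v h else τ.prob (A.endpoint v h)

end Strategies

section Probability

variable {V E : Type*} {A : Arena V E} [Finite E] [MeasurableSpace E] [DiscreteMeasurableSpace E]

/-- The transition kernel giving the law of edge number `n + 1` from edges number `0, …, n`. -/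
def Strategy.stepKernel (σ : A.Strategy) (τ : A.StochasticModel) (v : V) (n : ℕ) :
    Kernel (Finset.Iic n → E) E :=
  Kernel.ofFunOfCountable fun x =>
    (σ.step τ v (List.ofFn fun i : Fin (n + 1) =>
      x ⟨i, Finset.mem_Iic.2 (Nat.lt_succ_iff.1 i.2)⟩)).toMeasure

instance (σ : A.Strategy) (τ : A.StochasticModel) (v : V) (n : ℕ) :
    IsMarkovKernel (σ.stepKernel τ v n) :=
  ⟨fun _ => PMF.toMeasure.isProbabilityMeasure _⟩

/-- The probability measure on plays from `v`, when Eve plays `σ` and Adam follows `τ`. -/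
def Strategy.playMeasure (σ : A.Strategy) (τ : A.StochasticModel) (v : V) : Measure (ℕ → E) :=
  Kernel.trajMeasure (X := fun _ => E) (σ.step τ v []).toMeasure (σ.stepKernel τ v)

/-- The strategy `σ` satisfies the beyond worst-case problem from `v` with thresholds `(α, β)`:
all plays from `v` consistent with `σ` have mean payoff above `α`, and the expected mean payoff
against the stochastic model is above `β`. -/
structure Strategy.SatisfiesBWC (σ : A.Strategy) (τ : A.StochasticModel) (col : E → ℤ)
    (α β : ℚ) (v : V) : Prop where
  worst_case : ∀ ρ, A.IsPlayIn Set.univ v ρ → σ.Consistent v ρ → (α : ℝ) < meanPayoff col ρ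
  expectation : (β : ℝ) < ∫ ρ, meanPayoff col ρ ∂(σ.playMeasure τ v)

end Probability

section EndComponents

variable {V E : Type*} {A : Arena V E}

/-- The edges that leave a vertex of Eve or have positive probability. -/
def StochasticModel.edges (τ : A.StochasticModel) : Set E :=
  {e | A.src e ∉ A.eve → 0 < τ.prob (A.src e) e}

/-- The edges of positive probability (or of Eve) inside `U`. -/
def StochasticModel.edgesWithin (τ : A.StochasticModel) (U : Set V) : Set E :=
  {e | e ∈ τ.edges ∧ A.src e ∈ U ∧ A.tgt e ∈ U}

/-- `U` is an end component of the Markov decision process: it is nonempty, no edge of positive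
probability leaves it from a random vertex, and any two vertices of `U` (equal or not) are linked
by a path with at least one edge inside `U`. -/
structure StochasticModel.IsEndComponent (τ : A.StochasticModel) (U : Set V) : Prop where
  nonempty : U.Nonempty
  closed : ∀ e ∈ τ.edges, A.src e ∈ U → A.src e ∉ A.eve → A.tgt e ∈ U
  connected : ∀ u ∈ U, ∀ w ∈ U,
    Relation.TransGen (fun x y => ∃ e ∈ τ.edgesWithin U, A.src e = x ∧ A.tgt e = y) u w

variable (A) in
/-- In the game restricted to the edges in `F`, Eve has a (pure) strategy `f` from `v` that ensures
a strictly positive mean payoff against every strategy of Adam. -/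
def EnsuresPositive (F : Set E) (col : E → ℤ) (v : V) : Prop :=
  ∃ f : List E → E,
    (∀ h, A.IsPathIn F v h → A.endpoint v h ∈ A.eve → f h ∈ F ∧ A.src (f h) = A.endpoint v h) ∧
    ∀ ρ, A.IsPlayIn F v ρ → (∀ n, A.vertexAt v ρ n ∈ A.eve → ρ n = f (history ρ n)) →
      0 < meanPayoff col ρ

/-- The set of end components. -/
def StochasticModel.endComponents (τ : A.StochasticModel) : Set (Set V) :=
  {U | τ.IsEndComponent U}

/-- The set of winning end components: from each of its vertices Eve ensures a strictly positive
mean payoff while staying inside, if Adam only uses edges of positive probability. -/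
def StochasticModel.winningEndComponents (τ : A.StochasticModel) (col : E → ℤ) : Set (Set V) :=
  {U | U ∈ τ.endComponents ∧ ∀ v ∈ U, A.EnsuresPositive (τ.edgesWithin U) col v}

/-- End components that are not winning. -/
def StochasticModel.losingEndComponents (τ : A.StochasticModel) (col : E → ℤ) : Set (Set V) :=
  τ.endComponents \ τ.winningEndComponents col

end EndComponents

end Arena

end BWC

end

/-!
The memory structure turns the play into a Markov chain on the finite set of states
`(vertex, memory)`. Almost every play is fair for this chain: it uses only edges of positive
probability, and in each state that it visits infinitely often it takes each edge of positive
probability infinitely often (`Strategy.ae_mem_support`, `Strategy.ae_frequently_eq`,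
`MemoryStrategy.ae_isFair`). The rest concerns one fair play `ρ`.

The set `S` of states visited infinitely often by `ρ` is closed under edges of positive probability
(`MemoryStrategy.IsFair.next_mem_infStates`). Its projection to the vertices is the set `U` of
vertices visited infinitely often, which is therefore an end component: random vertices of `U` have
no positive edge out of it, and the tail of `ρ` links any two of its vertices inside it
(`MemoryStrategy.IsFair.isEndComponent`).

To win the game restricted to `U` from a vertex `u`, Eve picks a state `(u, m)` of `S` and plays as
the given strategy does with memory `m`, resolving its random choices in some way
(`MemoryStrategy.ensuresPositive`). The play stays in `S`, hence in `U`. Put after the prefix of `ρ`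
that leads to `(u, m)`, it is a play from the initial vertex consistent with the given strategy, so
the worst-case condition makes its mean payoff positive; and a finite prefix does not matter for
that (`meanPayoff_pos_of_splice`). So `U` is winning for every fair `ρ`, that is, almost surely.
-/

namespace BWC

/-! ### Finite prefixes of plays -/

section Histories

variable {V E : Type*} (A : Arena V E)

theorem history_succ (ρ : ℕ → E) (n : ℕ) : history ρ (n + 1) = history ρ n ++ [ρ n] := by
  rw [history, List.ofFn_succ', List.concat_eq_append]
  rfl

theorem history_congr {ρ ρ' : ℕ → E} {n : ℕ} (h : ∀ i < n, ρ i = ρ' i) :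
    history ρ n = history ρ' n := by
  unfold history
  congr 1
  funext i
  exact h i i.2

namespace Arena

@[simp]
theorem endpoint_nil (v : V) : A.endpoint v [] = v := rfl

@[simp]
theorem endpoint_concat (v : V) (h : List E) (e : E) : A.endpoint v (h ++ [e]) = A.tgt e := by
  simp [endpoint]

theorem endpoint_append (v : V) (h h' : List E) :
    A.endpoint v (h ++ h') = A.endpoint (A.endpoint v h) h' := by
  induction h' using List.reverseRecOn with
  | nil => simp
  | append_singleton l e _ => rw [← List.append_assoc, endpoint_concat, endpoint_concat]

theorem vertexAt_succ (v : V) (ρ : ℕ → E) (n : ℕ) : A.vertexAt v ρ (n + 1) = A.tgt (ρ n) := by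
  simp [vertexAt, history_succ]

theorem endpoint_mem_of_isPathIn {F : Set E} {U : Set V} (hF : ∀ e ∈ F, A.tgt e ∈ U) {v : V}
    (hv : v ∈ U) {h : List E} (hh : A.IsPathIn F v h) : A.endpoint v h ∈ U := by
  rcases List.eq_nil_or_concat h with rfl | ⟨l, e, rfl⟩
  · exact hv
  · have := (hh l.length (by simp)).1
    rw [List.concat_eq_append] at *
    rw [endpoint_concat]
    exact hF e (by simpa using this)

end Arena

end Histories

/-! ### The mean payoff does not depend on a finite prefix -/

section MeanPayoff

variable {E : Type*}

/-- The sequence that starts with the first `n` terms of `ρ` and goes on with `ρ'`. -/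
def splice (ρ : ℕ → E) (n : ℕ) (ρ' : ℕ → E) : ℕ → E :=
  fun k => if k < n then ρ k else ρ' (k - n)

theorem splice_of_lt (ρ ρ' : ℕ → E) {n k : ℕ} (h : k < n) : splice ρ n ρ' k = ρ k := if_pos h

theorem splice_add (ρ ρ' : ℕ → E) (n k : ℕ) : splice ρ n ρ' (n + k) = ρ' k := by
  simp [splice]

theorem history_splice_of_le (ρ ρ' : ℕ → E) {n k : ℕ} (h : k ≤ n) :
    history (splice ρ n ρ') k = history ρ k :=
  history_congr fun _ hi => splice_of_lt ρ ρ' (hi.trans_le h)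

theorem history_splice_add (ρ ρ' : ℕ → E) (n k : ℕ) :
    history (splice ρ n ρ') (n + k) = history ρ n ++ history ρ' k := by
  induction k with
  | zero => simpa [history] using history_splice_of_le ρ ρ' le_rfl
  | succ k ih => rw [← add_assoc, history_succ, ih, splice_add, history_succ, List.append_assoc]

/-- The averages are uniformly bounded, so the real-valued `liminf` in `meanPayoff` is genuine. -/
theorem exists_abs_average_le [Finite E] (col : E → ℤ) :
    ∃ C : ℝ, ∀ (ρ : ℕ → E) (n : ℕ), |(∑ i ∈ Finset.range n, (col (ρ i) : ℝ)) / n| ≤ C := by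
  obtain ⟨C, hC⟩ := (Set.finite_range fun e => |(col e : ℝ)|).bddAbove
  refine ⟨max C 0, fun ρ n => ?_⟩
  rcases Nat.eq_zero_or_pos n with rfl | hn
  · simp
  have hn' : (0 : ℝ) < n := by exact_mod_cast hn
  rw [abs_div, Nat.abs_cast, div_le_iff₀ hn']
  calc |∑ i ∈ Finset.range n, (col (ρ i) : ℝ)| ≤ ∑ i ∈ Finset.range n, |(col (ρ i) : ℝ)| :=
        Finset.abs_sum_le_sum_abs _ _
    _ ≤ ∑ _i ∈ Finset.range n, max C 0 :=
        Finset.sum_le_sum fun i _ => (hC ⟨ρ i, rfl⟩).trans (le_max_left _ _)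
    _ = max C 0 * n := by simp [mul_comm]

/-- Removing a finite prefix does not destroy positivity of the mean payoff. -/
theorem meanPayoff_pos_of_splice [Finite E] (col : E → ℤ) {ρ ρ' : ℕ → E} {n : ℕ}
    (h : 0 < meanPayoff col (splice ρ n ρ')) : 0 < meanPayoff col ρ' := by
  obtain ⟨C, hC⟩ := exists_abs_average_le col
  obtain ⟨c, hc0, hc⟩ := exists_between h
  have hev := eventually_lt_of_lt_liminf hc
    (isBoundedUnder_of ⟨-C, fun k => (abs_le.1 (hC _ k)).1⟩)
  set K : ℝ := ∑ i ∈ Finset.range n, (col (ρ i) : ℝ) with hK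
  have hcob : IsCoboundedUnder (· ≥ ·) atTop
      fun k : ℕ => (∑ i ∈ Finset.range k, (col (ρ' i) : ℝ)) / k :=
    (isBoundedUnder_of ⟨C, fun k => (abs_le.1 (hC _ k)).2⟩).isCoboundedUnder_ge
  refine (half_pos hc0).trans_le (le_liminf_of_le hcob ?_)
  obtain ⟨N, hN⟩ := eventually_atTop.1 hev
  -- past this bound, half of the slope `c` absorbs the payoff `K` of the prefix
  obtain ⟨B, hB⟩ := exists_nat_gt (2 * K / c)
  filter_upwards [eventually_ge_atTop (max N (max B 1))] with k hk
  have hk1 : (0 : ℝ) < k := by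
    have : 1 ≤ k := le_trans (by simp) hk
    exact_mod_cast this
  have hkB : 2 * K / c < k := hB.trans_le (by
    have : B ≤ k := le_trans (by simp) hk
    exact_mod_cast this)
  have hkN : N ≤ n + k := (le_trans (le_max_left _ _) hk).trans (Nat.le_add_left _ _)
  have h1 := hN _ hkN
  rw [Finset.sum_range_add, Finset.sum_congr rfl (g := fun i => (col (ρ i) : ℝ))
    (fun i hi => by rw [splice_of_lt _ _ (Finset.mem_range.1 hi)]), ← hK] at h1
  simp only [splice_add] at h1
  push_cast at h1
  rw [lt_div_iff₀ (by positivity)] at h1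
  rw [div_lt_iff₀ hc0] at hkB
  rw [le_div_iff₀ hk1]
  have : 0 ≤ c * n := by positivity
  nlinarith

end MeanPayoff

namespace Arena

/-! ### Plays under the play measure -/

section PlayMeasure

open scoped ENNReal

variable {V E : Type*} {A : Arena V E} [Finite E] [MeasurableSpace E] [DiscreteMeasurableSpace E]

instance (σ : A.Strategy) (τ : A.StochasticModel) (v : V) :
    IsProbabilityMeasure (σ.playMeasure τ v) := by
  unfold Strategy.playMeasure
  have := PMF.toMeasure.isProbabilityMeasure (σ.step τ v [])
  infer_instance

theorem measurable_of_dependsOn_Iio [Nonempty E] {β : Type*} [MeasurableSpace β]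
    {f : (ℕ → E) → β} {n : ℕ} (hf : DependsOn f (Set.Iio n)) : Measurable f := by
  have : f = (fun x : Fin n → E =>
      f fun i => if h : i < n then x ⟨i, h⟩ else Classical.arbitrary E) ∘ fun ρ i => ρ i := by
    funext ρ
    refine hf fun i hi => ?_
    simp [Set.mem_Iio.1 hi]
  rw [this]
  exact (measurable_of_finite _).comp (measurable_pi_lambda _ fun i => measurable_pi_apply _)

theorem Strategy.playMeasure_map_zero (σ : A.Strategy) (τ : A.StochasticModel) (v : V) :
    (σ.playMeasure τ v).map (fun ρ => ρ 0) = (σ.step τ v []).toMeasure := by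
  have h1 : (σ.playMeasure τ v).map (Preorder.frestrictLe (π := fun _ => E) 0) =
      (σ.step τ v []).toMeasure.map
        (MeasurableEquiv.piUnique fun _ : Finset.Iic (0 : ℕ) => E).symm := by
    rw [playMeasure, Kernel.trajMeasure, Measure.map_comp _ _ (by fun_prop),
      Kernel.traj_map_frestrictLe, Kernel.partialTraj_self, Measure.id_comp]
  have h2 := congrArg (Measure.map fun x : Finset.Iic (0 : ℕ) → E => x default) h1
  rw [Measure.map_map (by fun_prop) (by fun_prop), Measure.map_map (by fun_prop) (by fun_prop)] at h2
  refine Eq.trans ?_ (h2.trans ?_)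
  · rfl
  · exact Measure.map_id

/-- The conditional law of edge number `n` given the edges before it is `step`, tested on functions of
the first `n` edges and the next one. -/
theorem Strategy.lintegral_playMeasure (σ : A.Strategy) (τ : A.StochasticModel) (v : V) (n : ℕ)
    {f : (ℕ → E) → E → ℝ≥0∞} (hf : DependsOn f (Set.Iio n)) :
    ∫⁻ ρ, f ρ (ρ n) ∂(σ.playMeasure τ v) =
      ∫⁻ ρ, ∫⁻ e, f ρ e ∂(σ.step τ v (history ρ n)).toMeasure ∂(σ.playMeasure τ v) := by
  have : Nonempty E := ⟨(A.exists_edge v).choose⟩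
  cases n with
  | zero =>
    have hconst : ∀ ρ, f ρ = f fun _ => Classical.arbitrary E := fun ρ =>
      hf fun i hi => absurd hi (Nat.not_lt_zero i)
    simp only [hconst, history, List.ofFn_zero, lintegral_const, measure_univ, mul_one]
    rw [← σ.playMeasure_map_zero τ v, lintegral_map .of_discrete (by fun_prop)]
  | succ a =>
    set F : (Finset.Iic a → E) → E → ℝ≥0∞ := fun x =>
      f fun i => if h : i ≤ a then x ⟨i, Finset.mem_Iic.2 h⟩ else Classical.arbitrary E with hF
    have hfF : ∀ ρ, f ρ = F (Preorder.frestrictLe (π := fun _ => E) a ρ) := fun ρ =>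
      hf fun i hi => by simp [Nat.lt_succ_iff.1 (Set.mem_Iio.1 hi)]
    have key := Kernel.map_frestrictLe_trajMeasure_compProd_eq_map_trajMeasure
      (X := fun _ => E) (μ₀ := (σ.step τ v []).toMeasure) (κ := σ.stepKernel τ v) (a := a)
    have h2 := congrArg (fun μ => ∫⁻ p, F p.1 p.2 ∂μ) key
    have hm : Measurable fun p : (Finset.Iic a → E) × E => F p.1 p.2 := measurable_of_finite _
    rw [Measure.lintegral_compProd hm, lintegral_map hm (by fun_prop),
      lintegral_map (measurable_of_finite _) (by fun_prop)] at h2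
    simp only [hfF]
    exact h2.symm

/-- Almost surely, every edge of the play has positive probability given the edges before it. -/
theorem Strategy.ae_mem_support (σ : A.Strategy) (τ : A.StochasticModel) (v : V) :
    ∀ᵐ ρ ∂(σ.playMeasure τ v), ∀ n, ρ n ∈ (σ.step τ v (history ρ n)).support := by
  classical
  have : Nonempty E := ⟨(A.exists_edge v).choose⟩
  refine ae_all_iff.2 fun n => ?_
  -- the indicator of the edges of probability zero
  set f : (ℕ → E) → E → ℝ≥0∞ := fun ρ e =>
    if e ∈ (σ.step τ v (history ρ n)).support then 0 else 1 with hfdef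
  have hf : DependsOn f (Set.Iio n) := fun ρ ρ' h => by
    simp only [hfdef, history_congr h]
  have h0 : ∫⁻ ρ, f ρ (ρ n) ∂(σ.playMeasure τ v) = 0 := by
    rw [σ.lintegral_playMeasure τ v n hf]
    refine (lintegral_congr fun ρ => ?_).trans lintegral_zero
    rw [lintegral_eq_zero_iff .of_discrete, Filter.EventuallyEq,
      ae_iff, PMF.toMeasure_apply_eq_zero_iff _ .of_discrete, Set.disjoint_left]
    intro e he
    simp [hfdef, (PMF.mem_support_iff _ _).1 he]
  have hm : Measurable fun ρ : ℕ → E => f ρ (ρ n) :=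
    measurable_of_dependsOn_Iio (n := n + 1) fun ρ ρ' h => by
      rw [hf fun i hi => h i (Nat.lt_succ_of_lt hi), h n (Nat.lt_succ_self n)]
  filter_upwards [(lintegral_eq_zero_iff hm).1 h0] with ρ hρ
  by_contra hn
  simp only [hfdef, if_neg hn] at hρ
  exact one_ne_zero hρ

/-- A conditional Borel–Cantelli lemma. With `p` a lower bound for the probability of `e` after the
histories satisfying `P`, the product over time of the factors `0` (when `e` is taken in `P`),
`1 + p` (when another edge is taken in `P`) and `1` (outside `P`) is a supermartingale. By Fatou's
lemma it does not tend to infinity, which it would do on a play that is infinitely often in `P` but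
eventually never takes `e` there. -/
theorem Strategy.ae_frequently_eq (σ : A.Strategy) (τ : A.StochasticModel) (v : V)
    (P : List E → Prop) (e : E) {p : ℝ≥0∞} (hp : p ≠ 0)
    (hP : ∀ h, P h → p ≤ σ.step τ v h e) :
    ∀ᵐ ρ ∂(σ.playMeasure τ v), (∃ᶠ n in atTop, P (history ρ n)) →
      ∃ᶠ n in atTop, P (history ρ n) ∧ ρ n = e := by
  classical
  have : Nonempty E := ⟨e⟩
  set G : (ℕ → E) → ℕ → E → ℝ≥0∞ := fun ρ i e' =>
    if P (history ρ i) then if e' = e then 0 else 1 + p else 1 with hG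
  set X : ℕ → ℕ → (ℕ → E) → ℝ≥0∞ := fun N n ρ =>
    ∏ i ∈ Finset.range n, G ρ (N + i) (ρ (N + i)) with hX
  have hXdep : ∀ N n, DependsOn (X N n) (Set.Iio (N + n)) := fun N n ρ ρ' h => by
    refine Finset.prod_congr rfl fun i hi => ?_
    have hi' : N + i < N + n := Nat.add_lt_add_left (Finset.mem_range.1 hi) N
    simp only [hG]
    rw [history_congr fun j hj => h j (lt_trans hj hi'), h (N + i) hi']
  have hfac : ∀ ρ n, ∫⁻ e', G ρ n e' ∂(σ.step τ v (history ρ n)).toMeasure ≤ 1 := by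
    intro ρ n
    by_cases hPn : P (history ρ n)
    · set q := σ.step τ v (history ρ n) with hq
      have hle : p ≤ q e := hP _ hPn
      have hint : ∫⁻ e', G ρ n e' ∂q.toMeasure = (1 + p) * q.toMeasure {e}ᶜ := by
        rw [← lintegral_indicator_const (MeasurableSet.of_discrete)]
        refine lintegral_congr fun e' => ?_
        by_cases he : e' = e <;> simp [hG, hPn, he]
      have hq1 : q e ≤ 1 := q.coe_le_one e
      rw [hint, prob_compl_eq_one_sub .of_discrete,
        PMF.toMeasure_apply_singleton _ _ .of_discrete]
      calc (1 + p) * (1 - q e) ≤ (1 + q e) * (1 - q e) := by gcongr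
        _ = (1 - q e) + q e * (1 - q e) := by ring
        _ ≤ (1 - q e) + q e * 1 := by gcongr; exact tsub_le_self
        _ = 1 := by rw [mul_one, tsub_add_cancel_of_le hq1]
    · simp [hG, hPn]
  have hXle : ∀ N n, ∫⁻ ρ, X N n ρ ∂(σ.playMeasure τ v) ≤ 1 := by
    intro N n
    induction n with
    | zero => simp [hX]
    | succ n ih =>
      refine le_trans ?_ ih
      have hdep : DependsOn (fun ρ e' => X N n ρ * G ρ (N + n) e') (Set.Iio (N + n)) := by
        intro ρ ρ' h
        simp only [hXdep N n h, hG, history_congr h]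
      have := σ.lintegral_playMeasure τ v (N + n) hdep
      simp only [hX, Finset.prod_range_succ] at this ⊢
      rw [this]
      refine lintegral_mono fun ρ => ?_
      simp only
      rw [lintegral_const_mul _ .of_discrete]
      exact mul_le_of_le_one_right' (hfac ρ (N + n))
  have hlim : ∀ᵐ ρ ∂(σ.playMeasure τ v), ∀ N, liminf (fun n => X N n ρ) atTop < ∞ := by
    refine ae_all_iff.2 fun N => ?_
    have hmeas : ∀ n, Measurable (X N n) := fun n => measurable_of_dependsOn_Iio (hXdep N n)
    refine ae_lt_top (Measurable.liminf hmeas) (ne_top_of_le_ne_top ENNReal.one_ne_top ?_)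
    refine (lintegral_liminf_le hmeas).trans ?_
    exact liminf_le_of_frequently_le' (Frequently.of_forall fun n => hXle N n)
  filter_upwards [hlim] with ρ hρ hfreq
  by_contra hnot
  obtain ⟨N, hN⟩ := eventually_atTop.1 (not_frequently.1 hnot)
  refine (hρ N).ne ?_
  refine Tendsto.liminf_eq ?_
  have hGeq : ∀ i, G ρ (N + i) (ρ (N + i)) = if P (history ρ (N + i)) then 1 + p else 1 := by
    intro i
    by_cases hPi : P (history ρ (N + i))
    · have : ρ (N + i) ≠ e := fun h => hN _ (Nat.le_add_right N i) ⟨hPi, h⟩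
      simp [hG, hPi, this]
    · simp [hG, hPi]
  have hXeq : ∀ n, X N n ρ = (1 + p) ^ Nat.count (fun i => P (history ρ (N + i))) n := by
    intro n
    simp only [hX, hGeq, Finset.prod_ite, Finset.prod_const, one_pow, mul_one,
      Nat.count_eq_card_filter_range]
  simp only [hXeq]
  refine (ENNReal.tendsto_pow_atTop_nhds_top_iff.2 ?_).comp ?_
  · exact ENNReal.lt_add_right ENNReal.one_ne_top hp
  · have hinf : {i | P (history ρ (N + i))}.Infinite := by
      rw [← Nat.frequently_atTop_iff_infinite, frequently_atTop]
      intro a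
      obtain ⟨b, hb, hPb⟩ := frequently_atTop.1 hfreq (N + a)
      exact ⟨b - N, by omega, by rwa [Nat.add_sub_cancel' (by omega)]⟩
    refine tendsto_atTop_atTop_of_monotone (Nat.count_monotone _) fun b => ?_
    exact ⟨Nat.nth (fun i => P (history ρ (N + i))) b, (Nat.count_nth_of_infinite hinf b).ge⟩

end PlayMeasure

/-! ### The product of the arena and the memory structure -/

section ProductChain

variable {V E M : Type*} {A : Arena V E}

/-- The state of the product of the arena and the memory structure after the path `h` from `v`. -/
def MemoryStrategy.state (σ : A.MemoryStrategy M) (v : V) (h : List E) : V × M :=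
  (A.endpoint v h, h.foldl σ.update σ.init)

/-- The state that follows `s` when the edge `e` is taken. -/
def MemoryStrategy.next (σ : A.MemoryStrategy M) (s : V × M) (e : E) : V × M :=
  (A.tgt e, σ.update s.2 e)

open Classical in
/-- The distribution of the edge taken in the state `s` of the product Markov chain. -/
noncomputable def MemoryStrategy.stateStep (σ : A.MemoryStrategy M) (τ : A.StochasticModel)
    (s : V × M) : PMF E :=
  if s.1 ∈ A.eve then σ.act s.1 s.2 else τ.prob s.1

theorem MemoryStrategy.toStrategy_step (σ : A.MemoryStrategy M) (τ : A.StochasticModel) (v : V)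
    (h : List E) : σ.toStrategy.step τ v h = σ.stateStep τ (σ.state v h) := rfl

theorem MemoryStrategy.state_concat (σ : A.MemoryStrategy M) (v : V) (h : List E) (e : E) :
    σ.state v (h ++ [e]) = σ.next (σ.state v h) e := by
  simp [state, next]

theorem MemoryStrategy.src_of_mem_support (σ : A.MemoryStrategy M) (τ : A.StochasticModel)
    {s : V × M} {e : E} (he : e ∈ (σ.stateStep τ s).support) : A.src e = s.1 := by
  unfold stateStep at he
  split_ifs at he with h
  · exact σ.legal _ h _ e he
  · exact τ.legal _ h e he

theorem MemoryStrategy.mem_edges_of_mem_support (σ : A.MemoryStrategy M) (τ : A.StochasticModel)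
    {s : V × M} {e : E} (he : e ∈ (σ.stateStep τ s).support) : e ∈ τ.edges := by
  intro h
  have hs := σ.src_of_mem_support τ he
  rw [hs] at h ⊢
  rw [stateStep, if_neg h] at he
  exact pos_iff_ne_zero.2 he

theorem MemoryStrategy.mem_support_of_mem_edges (σ : A.MemoryStrategy M) (τ : A.StochasticModel)
    {s : V × M} {e : E} (he : e ∈ τ.edges) (hs : A.src e = s.1) (h : s.1 ∉ A.eve) :
    e ∈ (σ.stateStep τ s).support := by
  rw [stateStep, if_neg h, PMF.mem_support_iff, ← hs]
  exact (he (hs ▸ h)).ne'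

/-- The states visited infinitely often by the play `ρ` from `v`. -/
def MemoryStrategy.infStates (σ : A.MemoryStrategy M) (v : V) (ρ : ℕ → E) : Set (V × M) :=
  {s | ∃ᶠ n in atTop, σ.state v (history ρ n) = s}

/-- A play is fair if it only uses edges of positive probability and takes infinitely often every
such edge of every state that it visits infinitely often. -/
structure MemoryStrategy.IsFair (σ : A.MemoryStrategy M) (τ : A.StochasticModel) (v : V)
    (ρ : ℕ → E) : Prop where
  mem_support : ∀ n, ρ n ∈ (σ.stateStep τ (σ.state v (history ρ n))).support
  frequently : ∀ s ∈ σ.infStates v ρ, ∀ e ∈ (σ.stateStep τ s).support,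
    ∃ᶠ n in atTop, σ.state v (history ρ n) = s ∧ ρ n = e

theorem MemoryStrategy.ae_isFair [Finite V] [Finite M] [Finite E] [MeasurableSpace E]
    [DiscreteMeasurableSpace E] (σ : A.MemoryStrategy M) (τ : A.StochasticModel) (v : V) :
    ∀ᵐ ρ ∂(σ.toStrategy.playMeasure τ v), σ.IsFair τ v ρ := by
  have h2 : ∀ᵐ ρ ∂(σ.toStrategy.playMeasure τ v), ∀ (s : V × M) (e : E),
      e ∈ (σ.stateStep τ s).support → s ∈ σ.infStates v ρ →
        ∃ᶠ n in atTop, σ.state v (history ρ n) = s ∧ ρ n = e := by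
    refine ae_all_iff.2 fun s => ae_all_iff.2 fun e => ?_
    by_cases he : e ∈ (σ.stateStep τ s).support
    · have := σ.toStrategy.ae_frequently_eq τ v (fun h => σ.state v h = s) e
        ((PMF.mem_support_iff _ _).1 he) (fun h hs => by rw [σ.toStrategy_step, hs])
      filter_upwards [this] with ρ hρ _ using hρ
    · exact .of_forall fun ρ h => absurd h he
  filter_upwards [σ.toStrategy.ae_mem_support τ v, h2] with ρ h1 h2
  exact ⟨h1, fun s hs e he => h2 s e he hs⟩

variable {σ : A.MemoryStrategy M} {τ : A.StochasticModel} {v : V} {ρ : ℕ → E}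

theorem MemoryStrategy.IsFair.src_eq (hρ : σ.IsFair τ v ρ) (n : ℕ) :
    A.src (ρ n) = A.vertexAt v ρ n :=
  σ.src_of_mem_support τ (hρ.mem_support n)

theorem MemoryStrategy.IsFair.next_mem_infStates (hρ : σ.IsFair τ v ρ) {s : V × M}
    (hs : s ∈ σ.infStates v ρ) {e : E} (he : e ∈ (σ.stateStep τ s).support) :
    σ.next s e ∈ σ.infStates v ρ := by
  refine frequently_atTop.2 fun a => ?_
  obtain ⟨b, hb, hbs, hbe⟩ := frequently_atTop.1 (hρ.frequently s hs e he) a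
  exact ⟨b + 1, by omega, by rw [history_succ, σ.state_concat, hbs, hbe]⟩

theorem MemoryStrategy.fst_mem_infVisited {s : V × M} (hs : s ∈ σ.infStates v ρ) :
    s.1 ∈ A.infVisited v ρ :=
  Frequently.mono hs fun _ h => congrArg Prod.fst h

theorem MemoryStrategy.exists_mem_infStates [Finite M] (σ : A.MemoryStrategy M) {u : V}
    (hu : u ∈ A.infVisited v ρ) : ∃ m, (u, m) ∈ σ.infStates v ρ := by
  by_contra! hcon
  have h : ∀ᶠ n in atTop, ∀ m, σ.state v (history ρ n) ≠ (u, m) :=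
    eventually_all.2 fun m => not_frequently.1 (hcon m)
  obtain ⟨n, hn, hn'⟩ := (Frequently.and_eventually hu h).exists
  exact hn' _ (Prod.ext hn rfl)

theorem eventually_vertexAt_mem_infVisited [Finite V] (A : Arena V E) (v : V) (ρ : ℕ → E) :
    ∀ᶠ n in atTop, A.vertexAt v ρ n ∈ A.infVisited v ρ := by
  have h : ∀ᶠ n in atTop, ∀ u, u ∉ A.infVisited v ρ → A.vertexAt v ρ n ≠ u :=
    eventually_all.2 fun u => by
      by_cases hu : u ∈ A.infVisited v ρ
      · exact .of_forall fun n h => absurd hu h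
      · exact (not_frequently.1 hu).mono fun n hn _ => hn
  filter_upwards [h] with n hn
  by_contra hc
  exact hn _ hc rfl

theorem MemoryStrategy.IsFair.isEndComponent [Finite V] [Finite M] (hρ : σ.IsFair τ v ρ) :
    τ.IsEndComponent (A.infVisited v ρ) := by
  obtain ⟨N, hN⟩ := eventually_atTop.1 (eventually_vertexAt_mem_infVisited A v ρ)
  refine ⟨⟨_, hN N le_rfl⟩, fun e he hsrc hadam => ?_, fun u hu w hw => ?_⟩
  · obtain ⟨m, hm⟩ := σ.exists_mem_infStates hsrc
    exact fst_mem_infVisited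
      (hρ.next_mem_infStates hm (σ.mem_support_of_mem_edges τ he rfl hadam))
  · obtain ⟨a, ha, rfl⟩ := frequently_atTop.1 hu N
    obtain ⟨b, hb, rfl⟩ := frequently_atTop.1 hw (a + 1)
    have hstep : ∀ k, N ≤ k → ∃ e ∈ τ.edgesWithin (A.infVisited v ρ),
        A.src e = A.vertexAt v ρ k ∧ A.tgt e = A.vertexAt v ρ (k + 1) := fun k hk =>
      ⟨ρ k, ⟨σ.mem_edges_of_mem_support τ (hρ.mem_support k), hρ.src_eq k ▸ hN k hk,
        A.vertexAt_succ v ρ k ▸ hN (k + 1) (by omega)⟩, hρ.src_eq k, (A.vertexAt_succ v ρ k).symm⟩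
    clear hu hw
    induction b, hb using Nat.le_induction with
    | base => exact .single (hstep a ha)
    | succ k hk ih => exact ih.tail (hstep k (by omega))

/-- In a set `S` of states closed under the edges of positive probability, Eve wins the restricted
game by following the finite-memory strategy from any state reached by a consistent play: any play of
the restricted game that follows it stays in `S`, and prefixed by the consistent play it becomes one
more consistent play. -/
theorem MemoryStrategy.ensuresPositive [Finite E] {col : E → ℤ}
    (hσ : ∀ ρ, A.IsPlayIn Set.univ v ρ → σ.toStrategy.Consistent v ρ → 0 < meanPayoff col ρ)
    (hρ : ∀ n, ρ n ∈ (σ.stateStep τ (σ.state v (history ρ n))).support)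
    {U : Set V} (hU : τ.IsEndComponent U) {S : Set (V × M)} (hSU : ∀ s ∈ S, s.1 ∈ U)
    (hS : ∀ s ∈ S, ∀ e ∈ (σ.stateStep τ s).support, σ.next s e ∈ S)
    {n : ℕ} (hn : σ.state v (history ρ n) ∈ S) :
    A.EnsuresPositive (τ.edgesWithin U) col (A.vertexAt v ρ n) := by
  have : Nonempty E := ⟨ρ 0⟩
  set u := A.vertexAt v ρ n with hu
  have hend : ∀ h, A.endpoint v (history ρ n ++ h) = A.endpoint u h := fun h =>
    A.endpoint_append v _ h
  -- off the plays that follow the strategy the path may be in a state outside `S`; there any edge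
  -- of the restricted game is a legal choice
  have hex : ∀ h, A.IsPathIn (τ.edgesWithin U) u h → A.endpoint u h ∈ A.eve →
      ∃ e, (e ∈ τ.edgesWithin U ∧ A.src e = A.endpoint u h) ∧
        (σ.state v (history ρ n ++ h) ∈ S →
          e ∈ (σ.stateStep τ (σ.state v (history ρ n ++ h))).support) := by
    intro h hh hE
    have hmem : A.endpoint u h ∈ U := A.endpoint_mem_of_isPathIn (fun e he => he.2.2) (hSU _ hn) hh
    by_cases hs : σ.state v (history ρ n ++ h) ∈ S
    · obtain ⟨e, he⟩ := (σ.stateStep τ (σ.state v (history ρ n ++ h))).support_nonempty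
      have hsrc : A.src e = A.endpoint u h := (σ.src_of_mem_support τ he).trans (hend h)
      exact ⟨e, ⟨⟨σ.mem_edges_of_mem_support τ he, hsrc ▸ hmem, hSU _ (hS _ hs e he)⟩, hsrc⟩,
        fun _ => he⟩
    · obtain ⟨_, ⟨e, he, hsrc, -⟩, -⟩ :=
        Relation.TransGen.head'_iff.1 (hU.connected _ hmem _ hmem)
      exact ⟨e, ⟨he, hsrc⟩, fun h' => absurd h' hs⟩
  choose! f hf1 hf2 using hex
  refine ⟨f, hf1, fun ρ' hplay hcons => ?_⟩
  have hpath : ∀ k, A.IsPathIn (τ.edgesWithin U) u (history ρ' k) := by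
    intro k i hi
    have hik : i < k := by simpa [history] using hi
    have hget : (history ρ' k)[i] = ρ' i := by simp [history]
    have htake : (history ρ' k).take i = history ρ' i := by
      refine List.ext_getElem (by simp [history]; omega) fun j h1 h2 => by simp [history]
    rw [hget, htake]
    exact hplay i
  have hsupp : ∀ k, σ.state v (history ρ n ++ history ρ' k) ∈ S →
      ρ' k ∈ (σ.stateStep τ (σ.state v (history ρ n ++ history ρ' k))).support := by
    intro k hk
    by_cases hE : A.vertexAt u ρ' k ∈ A.eve
    · rw [hcons k hE]
      exact hf2 _ (hpath k) hE hk
    · exact σ.mem_support_of_mem_edges τ (hplay k).1.1 ((hplay k).2.trans (hend _).symm)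
        (by rw [state, hend]; exact hE)
  have hin : ∀ k, σ.state v (history ρ n ++ history ρ' k) ∈ S := by
    intro k
    induction k with
    | zero => simpa [history] using hn
    | succ k ih =>
      rw [history_succ, ← List.append_assoc, σ.state_concat]
      exact hS _ ih _ (hsupp k ih)
  have hall : ∀ k, splice ρ n ρ' k ∈
      (σ.stateStep τ (σ.state v (history (splice ρ n ρ') k))).support := by
    intro k
    rcases lt_or_ge k n with hk | hk
    · rw [splice_of_lt _ _ hk, history_splice_of_le _ _ hk.le]
      exact hρ k
    · obtain ⟨j, rfl⟩ := Nat.exists_eq_add_of_le hk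
      rw [splice_add, history_splice_add]
      exact hsupp j (hin j)
  refine meanPayoff_pos_of_splice col (ρ := ρ) (n := n) (hσ _ (fun k => ⟨trivial, ?_⟩) fun k hk => ?_)
  · exact σ.src_of_mem_support τ (hall k)
  · have := hall k
    rw [stateStep, if_pos (show (σ.state v (history (splice ρ n ρ') k)).1 ∈ A.eve from hk)] at this
    exact this

theorem MemoryStrategy.IsFair.infVisited_mem_winningEndComponents [Finite V] [Finite M] [Finite E]
    {col : E → ℤ}
    (hσ : ∀ ρ, A.IsPlayIn Set.univ v ρ → σ.toStrategy.Consistent v ρ → 0 < meanPayoff col ρ)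
    (hρ : σ.IsFair τ v ρ) : A.infVisited v ρ ∈ τ.winningEndComponents col := by
  refine ⟨hρ.isEndComponent, fun u hu => ?_⟩
  obtain ⟨m, hm⟩ := σ.exists_mem_infStates hu
  obtain ⟨n, hn⟩ := Frequently.exists hm
  have hvert : A.vertexAt v ρ n = u := congrArg Prod.fst hn
  rw [← hvert]
  exact ensuresPositive hσ hρ.mem_support hρ.isEndComponent
    (fun s hs => fst_mem_infVisited hs) (fun s hs e he => hρ.next_mem_infStates hs he)
    (hn ▸ hm : σ.state v (history ρ n) ∈ σ.infStates v ρ)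

end ProductChain

end Arena

end BWC

theorem mainTheorem6 {V E M : Type*} [Finite V] [Finite E] [Finite M]
    [MeasurableSpace E] [DiscreteMeasurableSpace E]
    (A : BWC.Arena V E) (col : E → ℤ) (τ : A.StochasticModel) (β : ℚ)
    (v₀ : V) (σ : A.MemoryStrategy M)
    (hσ : σ.toStrategy.SatisfiesBWC τ col 0 β v₀) :
    σ.toStrategy.playMeasure τ v₀
        {ρ | A.infVisited v₀ ρ ∈ τ.winningEndComponents col} = 1 ∧
      σ.toStrategy.playMeasure τ v₀
        {ρ | A.infVisited v₀ ρ ∈ τ.losingEndComponents col} = 0 := by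
  have hwc : ∀ ρ, A.IsPlayIn Set.univ v₀ ρ → σ.toStrategy.Consistent v₀ ρ →
      0 < BWC.meanPayoff col ρ := fun ρ h1 h2 => by simpa using hσ.worst_case ρ h1 h2
  have hae : ∀ᵐ ρ ∂(σ.toStrategy.playMeasure τ v₀),
      A.infVisited v₀ ρ ∈ τ.winningEndComponents col := by
    filter_upwards [σ.ae_isFair τ v₀] with ρ hρ
    exact hρ.infVisited_mem_winningEndComponents hwc
  constructor
  · rw [measure_congr (eventuallyEq_univ.2 hae), measure_univ]
  · refine measure_mono_null (fun ρ hρ => ?_) (ae_iff.1 hae)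
    exact hρ.2
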